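/- Fix integers $\nu,n,m\ge 0$ and put $M=N+\nu$. For every $N$ let $\sigma,q$ be real numbers (possibly depending on $N$) with $q+\sigma>0$, and let $\sigma_1,\dots,\sigma_N$ and $q_1,\dots,q_M$ be real numbers (depending on $N$), the eigenvalues of the Hermitian matrices $\Sigma$ and $Q$ of the generalised Wishart ensemble with density proportional to $\exp[-\mathrm{Tr}(X\Sigma X^*)-\mathrm{Tr}(QXX^*)]$ on complex $M\times N$ matrices $X$, such that $q_j+\sigma_i>0$ for all $i,j$. The kernel of this ensemble is $$K_N(x,y)=\oint_{\gamma_\sigma}\frac{d\eta}{2\pi i}\oint_{\gamma_q}\frac{d\zeta}{2\pi i}\,\frac{e^{x\eta-y\zeta}}{\eta-\zeta}\prod_{l=1}^N\frac{\zeta+\sigma_l}{\eta+\sigma_l}\prod_{k=1}^M\frac{\eta-q_k}{\zeta-q_k},$$ where $\gamma_\sigma$ and $\gamma_q$ are any closed contours encircling counter-clockwise $-\sigma_1,\dots,-\sigma_N$ and $q_1,\dots,q_M$, respectively, and not intersecting each other. Assume the finite rank perturbation conditions $\sigma_{n+1}=\dots=\sigma_N=\sigma$ and $q_{m+1}=\dots=q_M=q$,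 and that the limits $$\hat\pi_l=\lim_{N\to\infty}\frac1N\,\frac{q+\sigma_l}{q+\sigma}\quad(l=1,\dots,n),\qquad \hat\theta_k=\lim_{N\to\infty}\frac1N\,\frac{q-q_k}{q+\sigma}\quad(k=1,\dots,m)$$ exist and are finite. Then for all real $\hat x,\hat y$ $$\lim_{N\to\infty}\frac{1}{(q+\sigma)N}\,K_N\!\left(\frac{\hat x}{(q+\sigma)N},\frac{\hat y}{(q+\sigma)N}\right)e^{-\frac{q}{(q+\sigma)N}(\hat x-\hat y)}=\mathbb K^{(n,m)}_{\mathrm{III}}(\hat x,\hat y),$$ where $$\mathbb K^{(n,m)}_{\mathrm{III}}(\hat x,\hat y)=\oint_{\Gamma_{\rm out}}\frac{dv}{2\pi i}\oint_{\Gamma_{\rm in}}\frac{du}{2\pi i}\,\frac{e^{-\hat xv+\hat yu}}{u-v}\,e^{-\frac1u+\frac1v}\Big(\frac vu\Big)^{\nu+n-m}\prod_{l=1}^n\frac{u-\hat\pi_l}{v-\hat\pi_l}\prod_{k=1}^m\frac{v-\hat\theta_k}{u-\hat\theta_k}$$ is the Bessel kernel with finite rank perturbations. Here $\Gamma_{\rm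 in}$ is any closed contour encircling counter-clockwise the origin and $\hat\theta_1,\dots,\hat\theta_m$, and $\Gamma_{\rm out}$ is any closed contour encircling counter-clockwise $\hat\pi_1,\dots,\hat\pi_n$ and the contour $\Gamma_{\rm in}$, without intersecting it. -/

import Mathlib

noncomputable section

namespace HardEdge

/-- A closed contour in the complex plane: a closed path `[0, 1] → ℂ` that is piecewise `C¹`, that
is, `C¹` up to the end points on every interval with no break point in its interior. -/
structure Contour where
  /-- the common start and end point -/
  base : ℂ
  /-- the closed path -/
  path : Path base base
  piecewise_contDiff : ∃ S : Finset ℝ, ∀ a b : ℝ, 0 ≤ a → a < b → b ≤ 1 →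
    Disjoint (S : Set ℝ) (Set.Ioo a b) → ContDiffOn ℝ 1 path.extend (Set.Icc a b)

/-- The set of points on the contour. -/
def Contour.trace (Γ : Contour) : Set ℂ := Set.range Γ.path

/-- The normalised contour integral `∮_Γ f(z) dz / (2πi)`. -/
def Contour.oint (Γ : Contour) (f : ℂ → ℂ) : ℂ :=
  (2 * (Real.pi : ℂ) * Complex.I)⁻¹ *
    curveIntegral (fun z : ℂ => f z • ContinuousLinearMap.id ℂ ℂ) Γ.path

/-- `Γ` encircles `w` (once, counter-clockwise): `w` is not on `Γ` and the winding number
`∮_Γ dz / (2πi (z - w))` of `Γ` about `w` is one. -/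
def Contour.Encircles (Γ : Contour) (w : ℂ) : Prop :=
  w ∉ Γ.trace ∧ Γ.oint (fun z => (z - w)⁻¹) = 1

/-- `Γ` encloses the contour `Γ'` without intersecting it: it encircles every point of `Γ'` and
every point that `Γ'` encircles. -/
def Contour.Encloses (Γ Γ' : Contour) : Prop :=
  ∀ z : ℂ, z ∈ Γ'.trace ∨ Γ'.Encircles z → Γ.Encircles z

/-- Admissible contours for the kernel of the generalised Wishart ensemble with eigenvalues
`σ 1, …, σ N` and `q 1, …, q M`: `γσ` encircles all the `-σ l`, `γq` encircles all the `q k`, and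
the two contours do not intersect. -/
structure WishartContours (N M : ℕ) (σ q : ℕ → ℝ) (γσ γq : Contour) : Prop where
  sigma : ∀ l ∈ Finset.Icc 1 N, γσ.Encircles (-(σ l : ℂ))
  q : ∀ k ∈ Finset.Icc 1 M, γq.Encircles (q k : ℂ)
  disjoint : Disjoint γσ.trace γq.trace

/-- The kernel of the generalised Wishart ensemble with eigenvalues `σ 1, …, σ N` and
`q 1, …, q M`, along the contours `γσ` (outer integration, variable `η`) and `γq` (inner
integration, variable `ζ`). -/
def wishartKernel (N M : ℕ) (σ q : ℕ → ℝ) (γσ γq : Contour) (x y : ℝ) : ℂ :=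
  γσ.oint fun η => γq.oint fun ζ =>
    Complex.exp (x * η - y * ζ) / (η - ζ) *
      (∏ l ∈ Finset.Icc 1 N, (ζ + (σ l : ℂ)) / (η + (σ l : ℂ))) *
      ∏ k ∈ Finset.Icc 1 M, (η - (q k : ℂ)) / (ζ - (q k : ℂ))

/-- Admissible contours for the perturbed Bessel kernel with parameters `π̂ 1, …, π̂ n` and
`θ̂ 1, …, θ̂ m`: `Γin` encircles the origin and all the `θ̂ k`; `Γout` encircles all the `π̂ l` and
encloses `Γin` without intersecting it. -/
structure BesselContours (n m : ℕ) (πh θh : ℕ → ℝ) (Γout Γin : Contour) : Prop where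
  zero : Γin.Encircles 0
  theta : ∀ k ∈ Finset.Icc 1 m, Γin.Encircles (θh k : ℂ)
  pi : ∀ l ∈ Finset.Icc 1 n, Γout.Encircles (πh l : ℂ)
  nested : Γout.Encloses Γin

/-- The Bessel kernel with finite rank perturbations, along the contours `Γout` (outer integration,
variable `v`) and `Γin` (inner integration, variable `u`). -/
def perturbedBesselKernel (n m ν : ℕ) (πh θh : ℕ → ℝ) (Γout Γin : Contour) (x y : ℝ) : ℂ :=
  Γout.oint fun v => Γin.oint fun u =>
    Complex.exp (-(x * v) + y * u) / (u - v) * Complex.exp (-(1 / u) + 1 / v) *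
      (v / u) ^ ((ν : ℤ) + (n : ℤ) - (m : ℤ)) *
      (∏ l ∈ Finset.Icc 1 n, (u - (πh l : ℂ)) / (v - (πh l : ℂ))) *
      ∏ k ∈ Finset.Icc 1 m, (v - (θh k : ℂ)) / (u - (θh k : ℂ))

end HardEdge

end

open Filter Topology HardEdge

noncomputable section

namespace HardEdge

open MeasureTheory

/-! ### Contour integrals and winding numbers. -/

namespace Contour

variable (Γ : Contour)

/-! Put `s = (q + σ) N` and substitute `η = q - s v`, `ζ = q - s u`. The poles `-σ_l` and `q_k`
become `p_l = (q + σ_l) / s` and `θ_k = (q - q_k) / s`, which equal `1 / N` and `0` apart from the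
perturbed ones, and those converge to `π̂_l` and `θ̂_k`. The unperturbed factors combine to `(v / u)
^ (ν + n - m)` times `((1 - 1/(N u)) / (1 - 1/(N v))) ^ (N - n)`, and the latter tends to `exp (-1/u
+ 1/v)`. It remains to work on fixed contours and to pass to the limit under the integrals.

Fixed contours: encircling is an open condition (`Encircles.eventually`), so for large `N` the
contours `Γout`, `Γin` encircle all rescaled poles, and their affine images are admissible for the
Wishart kernel. The kernel is the same for all admissible contours (`exists_oint_oint_eq`). This is
shown without deformation of contours: partial fractions and divided differences express the
integrals through winding numbers about the poles, which are all one. The inner contour may wind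
around the outer one any number of times; that number is constant along the outer contour and
multiplies the integral of an entire function, which vanishes.

Limit: the integrand is uniformly bounded on the compact product of the traces, so dominated
convergence applies to the inner and then to the outer integral (`tendsto_oint_oint`). -/

lemma oint_eq (f : ℂ → ℂ) :
    Γ.oint f = (2 * (Real.pi : ℂ) * Complex.I)⁻¹ *
      ∫ t in (0 : ℝ)..1, f (Γ.path.extend t) * deriv Γ.path.extend t := by
  rw [oint, curveIntegral_eq_intervalIntegral_deriv]
  simp

lemma extend_mem_trace (t : ℝ) : Γ.path.extend t ∈ Γ.trace := by
  rw [trace, ← Path.extend_range]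
  exact Set.mem_range_self t

lemma trace_eq_range_extend : Γ.trace = Set.range Γ.path.extend := by
  rw [trace, Path.extend_range]

lemma isCompact_trace : IsCompact Γ.trace := isCompact_range Γ.path.continuous

lemma isPreconnected_trace : IsPreconnected Γ.trace := isPreconnected_range Γ.path.continuous

lemma exists_finset_differentiableAt : ∃ S : Finset ℝ, ∀ t ∈ Set.Ioo (0 : ℝ) 1, t ∉ S →
    DifferentiableAt ℝ Γ.path.extend t := by
  obtain ⟨S, hS⟩ := Γ.piecewise_contDiff
  refine ⟨S, fun t ht htS => ?_⟩
  have hopen : Set.Ioo (0 : ℝ) 1 ∩ (S : Set ℝ)ᶜ ∈ 𝓝 t :=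
    (isOpen_Ioo.inter S.finite_toSet.isClosed.isOpen_compl).mem_nhds ⟨ht, htS⟩
  obtain ⟨ε, hε, hball⟩ := Metric.mem_nhds_iff.1 hopen
  have hsub : Set.Icc (t - ε / 2) (t + ε / 2) ⊆ Set.Ioo (0 : ℝ) 1 ∩ (S : Set ℝ)ᶜ := by
    intro r hr
    apply hball
    rw [Metric.mem_ball, Real.dist_eq, abs_lt]
    constructor <;> linarith [hr.1, hr.2]
  have h1 := (hsub (Set.left_mem_Icc.2 (by linarith))).1.1
  have h2 := (hsub (Set.right_mem_Icc.2 (by linarith))).1.2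
  have hc := hS (t - ε / 2) (t + ε / 2) h1.le (by linarith) h2.le
    (Set.disjoint_left.2 fun r hrS hr => (hsub ⟨hr.1.le, hr.2.le⟩).2 hrS)
  exact (hc.differentiableOn one_ne_zero).differentiableAt
    (Icc_mem_nhds (by linarith) (by linarith))

/-- Induction on the number of break points inside the interval, splitting at one of them. On an
interval without break points the one-sided `C¹` condition gives a continuous `derivWithin`. -/
lemma intervalIntegrable_deriv :
    IntervalIntegrable (deriv Γ.path.extend) volume 0 1 := by
  obtain ⟨S, hS⟩ := Γ.piecewise_contDiff
  have key : ∀ (k : ℕ) (a b : ℝ), 0 ≤ a → a < b → b ≤ 1 →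
      (S.filter (· ∈ Set.Ioo a b)).card = k →
      IntervalIntegrable (deriv Γ.path.extend) volume a b := by
    intro k
    induction k using Nat.strong_induction_on with
    | _ k ih =>
      intro a b ha hab hb hk
      rcases (S.filter (· ∈ Set.Ioo a b)).eq_empty_or_nonempty with he | ⟨s, hs⟩
      · have hc := hS a b ha hab hb (Set.disjoint_left.2 fun r hrS hr => by
          have : r ∈ S.filter (· ∈ Set.Ioo a b) := Finset.mem_filter.2 ⟨hrS, hr⟩
          exact Finset.notMem_empty r (he ▸ this))
        have hcont := hc.continuousOn_derivWithin (uniqueDiffOn_Icc hab) le_rfl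
        have hi : IntervalIntegrable (derivWithin Γ.path.extend (Set.Icc a b)) volume a b :=
          (hcont.mono (by rw [Set.uIcc_of_le hab.le])).intervalIntegrable
        refine hi.congr_ae ?_
        -- The end points are discarded: `deriv` and `derivWithin` need only agree in the interior.
        rw [Set.uIoc_of_le hab.le, ← restrict_Ioo_eq_restrict_Ioc]
        filter_upwards [ae_restrict_mem measurableSet_Ioo] with r hr
        exact derivWithin_of_mem_nhds (Icc_mem_nhds hr.1 hr.2)
      · have hsS := (Finset.mem_filter.1 hs).2
        refine (ih _ ?_ a s ha hsS.1 (hsS.2.le.trans hb) rfl).trans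
          (ih _ ?_ s b (ha.trans hsS.1.le) hsS.2 hb rfl)
        · rw [← hk]
          refine Finset.card_lt_card (Finset.ssubset_iff_of_subset ?_ |>.2 ⟨s, hs, by simp⟩)
          intro r hr
          simp only [Finset.mem_filter, Set.mem_Ioo] at hr ⊢
          exact ⟨hr.1, hr.2.1, hr.2.2.trans hsS.2⟩
        · rw [← hk]
          refine Finset.card_lt_card (Finset.ssubset_iff_of_subset ?_ |>.2 ⟨s, hs, by simp⟩)
          intro r hr
          simp only [Finset.mem_filter, Set.mem_Ioo] at hr ⊢
          exact ⟨hr.1, hsS.1.trans hr.2.1, hr.2.2⟩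
  exact key _ 0 1 le_rfl one_pos le_rfl rfl

variable {Γ}

lemma continuous_comp_extend {f : ℂ → ℂ} (hf : ContinuousOn f Γ.trace) :
    Continuous fun t => f (Γ.path.extend t) :=
  hf.comp_continuous Γ.path.continuous_extend Γ.extend_mem_trace

lemma intervalIntegrable_mul_deriv {f : ℂ → ℂ} (hf : ContinuousOn f Γ.trace) :
    IntervalIntegrable (fun t => f (Γ.path.extend t) * deriv Γ.path.extend t) volume 0 1 :=
  Γ.intervalIntegrable_deriv.continuousOn_mul (continuous_comp_extend hf).continuousOn

lemma oint_congr {f g : ℂ → ℂ} (h : ∀ z ∈ Γ.trace, f z = g z) : Γ.oint f = Γ.oint g := by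
  simp only [oint_eq]
  congr 2
  ext t
  rw [h _ (Γ.extend_mem_trace t)]

lemma oint_const_mul (c : ℂ) (f : ℂ → ℂ) : Γ.oint (fun z => c * f z) = c * Γ.oint f := by
  simp only [oint_eq, mul_assoc, intervalIntegral.integral_const_mul]
  ring

lemma oint_add {f g : ℂ → ℂ} (hf : ContinuousOn f Γ.trace) (hg : ContinuousOn g Γ.trace) :
    Γ.oint (fun z => f z + g z) = Γ.oint f + Γ.oint g := by
  simp only [oint_eq, add_mul]
  rw [intervalIntegral.integral_add (intervalIntegrable_mul_deriv hf)
    (intervalIntegrable_mul_deriv hg), mul_add]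

lemma oint_sub {f g : ℂ → ℂ} (hf : ContinuousOn f Γ.trace) (hg : ContinuousOn g Γ.trace) :
    Γ.oint (fun z => f z - g z) = Γ.oint f - Γ.oint g := by
  simp only [oint_eq, sub_mul]
  rw [intervalIntegral.integral_sub (intervalIntegrable_mul_deriv hf)
    (intervalIntegrable_mul_deriv hg), mul_sub]

/-- A function with a primitive has zero integral along every closed contour. -/

lemma oint_eq_zero_of_hasDerivAt {f F : ℂ → ℂ} (hf : ContinuousOn f Γ.trace)
    (hF : ∀ z ∈ Γ.trace, HasDerivAt F (f z) z) : Γ.oint f = 0 := by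
  obtain ⟨S, hS⟩ := Γ.exists_finset_differentiableAt
  have hcont : ContinuousOn F Γ.trace := fun z hz => (hF z hz).continuousAt.continuousWithinAt
  rw [oint_eq, integral_eq_of_hasDerivAt_off_countable_of_le (fun t => F (Γ.path.extend t)) _
    zero_le_one S.countable_toSet (continuous_comp_extend hcont).continuousOn ?_
    (intervalIntegrable_mul_deriv hf)]
  · simp
  · intro t ht
    exact (hF _ (Γ.extend_mem_trace t)).comp t (hS t ht.1 ht.2).hasDerivAt

lemma oint_eq_zero_of_differentiable {f : ℂ → ℂ} (hf : Differentiable ℂ f) : Γ.oint f = 0 := by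
  obtain ⟨F, hF⟩ := hf.isExactOn_univ
  exact oint_eq_zero_of_hasDerivAt hf.continuous.continuousOn fun z _ => hF z trivial

lemma ne_of_mem_trace {w z : ℂ} (hw : w ∉ Γ.trace) (hz : z ∈ Γ.trace) : z - w ≠ 0 :=
  sub_ne_zero.2 fun h => hw (h ▸ hz)

/-- The quotient `(z - w') / (z - w)` stays in the unit disc about `1`, so its principal logarithm
is a primitive of the difference of the two Cauchy kernels along the contour. -/
lemma oint_inv_eq_of_norm_lt {w w' : ℂ} (h : ∀ z ∈ Γ.trace, ‖w' - w‖ < ‖z - w‖) :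
    w' ∉ Γ.trace ∧ Γ.oint (fun z => (z - w')⁻¹) = Γ.oint (fun z => (z - w)⁻¹) := by
  have hw : ∀ z ∈ Γ.trace, z - w ≠ 0 := fun z hz =>
    norm_pos_iff.1 ((norm_nonneg _).trans_lt (h z hz))
  have hw' : w' ∉ Γ.trace := fun hm => lt_irrefl _ (h w' hm)
  have hw'' : ∀ z ∈ Γ.trace, z - w' ≠ 0 := fun z hz => ne_of_mem_trace hw' hz
  have hc : ∀ a : ℂ, (∀ z ∈ Γ.trace, z - a ≠ 0) →
      ContinuousOn (fun z => (z - a)⁻¹) Γ.trace := fun a ha =>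
    (continuousOn_id.sub continuousOn_const).inv₀ ha
  refine ⟨hw', ?_⟩
  rw [← sub_eq_zero, ← oint_sub (hc _ hw'') (hc _ hw)]
  refine oint_eq_zero_of_hasDerivAt (F := fun z => Complex.log (1 - (w' - w) / (z - w)))
    ((hc _ hw'').sub (hc _ hw)) fun z hz => ?_
  have hslit : 1 - (w' - w) / (z - w) ∈ Complex.slitPlane := by
    refine Complex.mem_slitPlane_of_norm_lt_one (z := -((w' - w) / (z - w))) ?_
    rw [norm_neg, norm_div, div_lt_one (norm_pos_iff.2 (hw z hz))]
    exact h z hz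
  have hd : HasDerivAt (fun z => 1 - (w' - w) / (z - w)) ((w' - w) / (z - w) ^ 2) z := by
    have := ((((hasDerivAt_id z).sub_const w).inv (hw z hz)).const_mul (w' - w)).const_sub 1
    have h2 : -((w' - w) * (-1 / (id z - w) ^ 2)) = (w' - w) / (z - w) ^ 2 := by
      simp only [id]
      ring
    rw [← h2]
    exact this
  convert hd.clog hslit using 1
  have h1 := hw z hz
  have h2 := hw'' z hz
  have h3 : 1 - (w' - w) / (z - w) = (z - w') / (z - w) := by
    field_simp
    ring
  rw [h3]
  field_simp
  ring

/-- The winding number of a contour is locally constant off the contour. -/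

lemma eventually_oint_inv_eq {w : ℂ} (hw : w ∉ Γ.trace) :
    ∀ᶠ w' in 𝓝 w, w' ∉ Γ.trace ∧ Γ.oint (fun z => (z - w')⁻¹) = Γ.oint (fun z => (z - w)⁻¹) := by
  obtain ⟨ε, hε, hball⟩ := Metric.mem_nhds_iff.1
    (Γ.isCompact_trace.isClosed.isOpen_compl.mem_nhds hw)
  filter_upwards [Metric.ball_mem_nhds w hε] with w' hw'
  refine oint_inv_eq_of_norm_lt fun z hz => ?_
  rw [Metric.mem_ball, dist_eq_norm] at hw'
  refine hw'.trans_le ?_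
  by_contra! hlt
  exact hball (by rwa [Metric.mem_ball, dist_eq_norm]) hz

lemma Encircles.eventually {w : ℂ} (hw : Γ.Encircles w) : ∀ᶠ w' in 𝓝 w, Γ.Encircles w' := by
  filter_upwards [eventually_oint_inv_eq hw.1] with w' h
  exact ⟨h.1, h.2.trans hw.2⟩

/-- The winding number of a contour is constant along any contour disjoint from it. -/

lemma oint_inv_eq_of_disjoint {Γ' : Contour} (h : Disjoint Γ'.trace Γ.trace) {w w' : ℂ}
    (hw : w ∈ Γ'.trace) (hw' : w' ∈ Γ'.trace) :
    Γ.oint (fun z => (z - w)⁻¹) = Γ.oint (fun z => (z - w')⁻¹) := by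
  refine Γ'.isPreconnected_trace.induction₂
    (fun a b => Γ.oint (fun z => (z - a)⁻¹) = Γ.oint (fun z => (z - b)⁻¹)) (fun a ha => ?_)
    (fun a b c _ _ _ h₁ h₂ => h₁.trans h₂) (fun a b _ _ h₁ => h₁.symm) hw hw'
  have := eventually_oint_inv_eq (Set.disjoint_left.1 h ha)
  exact (this.filter_mono nhdsWithin_le_nhds).mono fun b hb => hb.2.symm

/-- The image of a contour under the affine map `z ↦ c z + b`. -/
def affine (Γ : Contour) (c b : ℂ) : Contour where
  base := c * Γ.base + b
  path := Γ.path.map (f := fun z => c * z + b) (by fun_prop)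
  piecewise_contDiff := by
    obtain ⟨S, hS⟩ := Γ.piecewise_contDiff
    refine ⟨S, fun s t hs hst ht hd => ?_⟩
    exact (contDiffOn_const.mul (hS s t hs hst ht hd)).add contDiffOn_const

lemma affine_trace (c b : ℂ) : (Γ.affine c b).trace = (fun z => c * z + b) '' Γ.trace := by
  rw [trace_eq_range_extend, trace_eq_range_extend, ← Set.range_comp]
  rfl

lemma affine_oint (c b : ℂ) (f : ℂ → ℂ) :
    (Γ.affine c b).oint f = c * Γ.oint (fun z => f (c * z + b)) := by
  have h : (Γ.affine c b).path.extend = fun t => c * Γ.path.extend t + b := rfl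
  have hd : deriv (Γ.affine c b).path.extend = fun t => c * deriv Γ.path.extend t := by
    ext t
    -- Both rules hold without differentiability, hence at break points too.
    rw [h, deriv_add_const, deriv_const_mul_field]
  rw [oint_eq, oint_eq, hd, h, mul_left_comm,
    ← intervalIntegral.integral_const_mul c]
  congr 1
  refine congrArg (fun g : ℝ → ℂ => ∫ t in (0 : ℝ)..1, g t) ?_
  funext t
  ring

lemma Encircles.affine {w c : ℂ} (hw : Γ.Encircles w) (hc : c ≠ 0) (b : ℂ) :
    (Γ.affine c b).Encircles (c * w + b) := by
  refine ⟨?_, ?_⟩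
  · rw [affine_trace]
    rintro ⟨z, hz, h⟩
    have : z = w := mul_left_cancel₀ hc (add_right_cancel h)
    exact hw.1 (this ▸ hz)
  · rw [affine_oint, ← oint_const_mul, ← hw.2]
    refine oint_congr fun z hz => ?_
    have := ne_of_mem_trace hw.1 hz
    rw [show c * z + b - (c * w + b) = c * (z - w) by ring]
    field_simp

end Contour

/-! ### Independence of the contours, by partial fractions. -/

/-- The monic polynomial function with the given multiset of roots. -/
def rootProd (s : Multiset ℂ) (z : ℂ) : ℂ := (s.map fun a => z - a).prod

@[simp] lemma rootProd_zero (z : ℂ) : rootProd 0 z = 1 := by simp [rootProd]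

@[simp] lemma rootProd_cons (a : ℂ) (s : Multiset ℂ) (z : ℂ) :
    rootProd (a ::ₘ s) z = (z - a) * rootProd s z := by simp [rootProd]

lemma differentiable_rootProd (s : Multiset ℂ) : Differentiable ℂ (rootProd s) := by
  induction s using Multiset.induction with
  | empty =>
    have : rootProd 0 = fun _ => 1 := by ext; simp
    rw [this]
    fun_prop
  | cons a s ih =>
    have : rootProd (a ::ₘ s) = fun z => (z - a) * rootProd s z := by ext; simp
    rw [this]
    fun_prop

namespace Contour

variable {Γ : Contour}

lemma rootProd_ne_zero {s : Multiset ℂ} (hs : ∀ a ∈ s, Γ.Encircles a) {z : ℂ}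
    (hz : z ∈ Γ.trace) : rootProd s z ≠ 0 := by
  refine Multiset.prod_ne_zero fun h => ?_
  obtain ⟨a, ha, h0⟩ := Multiset.mem_map.1 h
  exact ne_of_mem_trace (hs a ha).1 hz h0

lemma continuousOn_div_rootProd {s : Multiset ℂ} (hs : ∀ a ∈ s, Γ.Encircles a) {h : ℂ → ℂ}
    (hh : ContinuousOn h Γ.trace) : ContinuousOn (fun z => h z / rootProd s z) Γ.trace :=
  hh.div (differentiable_rootProd s).continuous.continuousOn fun _ hz => rootProd_ne_zero hs hz

lemma continuousOn_inv_rootProd {s : Multiset ℂ} (hs : ∀ a ∈ s, Γ.Encircles a) :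
    ContinuousOn (fun z => (rootProd s z)⁻¹) Γ.trace :=
  (differentiable_rootProd s).continuous.continuousOn.inv₀ fun _ hz => rootProd_ne_zero hs hz

lemma oint_inv_pow_eq_zero {a : ℂ} (ha : a ∉ Γ.trace) (k : ℕ) :
    Γ.oint (fun z => ((z - a) ^ (k + 2))⁻¹) = 0 := by
  refine oint_eq_zero_of_hasDerivAt (F := fun z => -((k : ℂ) + 1)⁻¹ * ((z - a) ^ (k + 1))⁻¹)
    ?_ fun z hz => ?_
  · exact ((continuousOn_id.sub continuousOn_const).pow _).inv₀ fun z hz =>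
      pow_ne_zero _ (ne_of_mem_trace ha hz)
  · have h0 := ne_of_mem_trace ha hz
    have hk : (k : ℂ) + 1 ≠ 0 := Nat.cast_add_one_ne_zero k
    refine (((((hasDerivAt_id z).sub_const a).fun_pow (k + 1)).fun_inv
      (pow_ne_zero _ h0)).const_mul (-((k : ℂ) + 1)⁻¹)).congr_deriv ?_
    push_cast
    simp only [id, mul_one]
    field_simp
    ring

/-- Two distinct roots are separated by partial fractions, which lowers the number of poles by one;
with two simple poles left, the winding numbers `1 - 1` cancel. If all roots coincide, the integrand
has a primitive. -/
lemma oint_inv_rootProd_eq_zero (k : ℕ) : ∀ s : Multiset ℂ, s.card = k + 2 →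
    (∀ a ∈ s, Γ.Encircles a) → Γ.oint (fun z => (rootProd s z)⁻¹) = 0 := by
  induction k with
  | zero =>
    intro s hcard hs
    obtain ⟨a, b, rfl⟩ := Multiset.card_eq_two.1 hcard
    have ha := hs a (by simp)
    have hb := hs b (by simp)
    by_cases hab : a = b
    · subst hab
      rw [← oint_inv_pow_eq_zero ha.1 0]
      refine oint_congr fun z _ => ?_
      simp [rootProd, pow_two]
    · have hab' := sub_ne_zero.2 hab
      have hca : ContinuousOn (fun z => (z - a)⁻¹) Γ.trace :=
        (continuousOn_id.sub continuousOn_const).inv₀ fun z hz => ne_of_mem_trace ha.1 hz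
      have hcb : ContinuousOn (fun z => (z - b)⁻¹) Γ.trace :=
        (continuousOn_id.sub continuousOn_const).inv₀ fun z hz => ne_of_mem_trace hb.1 hz
      have : Γ.oint (fun z => (rootProd {a, b} z)⁻¹) =
          Γ.oint fun z => (a - b)⁻¹ * ((z - a)⁻¹ - (z - b)⁻¹) := by
        refine oint_congr fun z hz => ?_
        have h1 := ne_of_mem_trace ha.1 hz
        have h2 := ne_of_mem_trace hb.1 hz
        simp only [rootProd, Multiset.insert_eq_cons, Multiset.map_cons, Multiset.map_singleton,
          Multiset.prod_cons, Multiset.prod_singleton]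
        field_simp
        ring
      rw [this, oint_const_mul, oint_sub hca hcb, ha.2, hb.2]
      simp
  | succ k ih =>
    intro s hcard hs
    obtain ⟨a, ha⟩ := Multiset.card_pos_iff_exists_mem.1 (by omega : 0 < s.card)
    obtain ⟨t, rfl⟩ := Multiset.exists_cons_of_mem ha
    by_cases hall : ∀ b ∈ t, b = a
    · have hrep : a ::ₘ t = Multiset.replicate (k + 1 + 2) a := by
        refine Multiset.eq_replicate.2 ⟨hcard, fun b hb => ?_⟩
        rcases Multiset.mem_cons.1 hb with h | h
        exacts [h, hall b h]
      rw [← oint_inv_pow_eq_zero (hs a (by simp)).1 (k + 1)]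
      refine oint_congr fun z _ => ?_
      rw [hrep, rootProd, Multiset.map_replicate, Multiset.prod_replicate]
    · push Not at hall
      obtain ⟨b, hb, hba⟩ := hall
      obtain ⟨u, rfl⟩ := Multiset.exists_cons_of_mem hb
      have hab' : a - b ≠ 0 := sub_ne_zero.2 hba.symm
      have ha : ∀ c ∈ a ::ₘ u, Γ.Encircles c := fun c hc => hs c (by
        rw [Multiset.mem_cons] at hc ⊢
        exact hc.imp_right (Multiset.mem_cons_of_mem))
      have hb : ∀ c ∈ b ::ₘ u, Γ.Encircles c := fun c hc => hs c (Multiset.mem_cons_of_mem hc)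
      have hu : ∀ c ∈ u, Γ.Encircles c := fun c hc => hb c (Multiset.mem_cons_of_mem hc)
      have : Γ.oint (fun z => (rootProd (a ::ₘ b ::ₘ u) z)⁻¹) =
          Γ.oint fun z => (a - b)⁻¹ * ((rootProd (a ::ₘ u) z)⁻¹ - (rootProd (b ::ₘ u) z)⁻¹) := by
        refine oint_congr fun z hz => ?_
        have h1 := ne_of_mem_trace (ha a (by simp)).1 hz
        have h2 := ne_of_mem_trace (hb b (by simp)).1 hz
        have h3 := rootProd_ne_zero hu hz
        simp only [rootProd_cons]
        field_simp
        ring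
      simp only [Multiset.card_cons] at hcard
      rw [this, oint_const_mul, oint_sub (continuousOn_inv_rootProd ha)
        (continuousOn_inv_rootProd hb), ih _ (by simp; omega) ha, ih _ (by simp; omega) hb]
      simp

lemma differentiable_dslope {h : ℂ → ℂ} (hh : Differentiable ℂ h) (a : ℂ) :
    Differentiable ℂ (dslope h a) :=
  differentiableOn_univ.1 ((Complex.differentiableOn_dslope univ_mem).2 hh.differentiableOn)

/-- The integral of `h / ∏ (z - a)`, with `h` entire, along a contour encircling all the poles
does not depend on the contour. -/

lemma exists_oint_div_rootProd_eq (s : Multiset ℂ) : ∀ h : ℂ → ℂ, Differentiable ℂ h →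
    ∃ L : ℂ, ∀ Γ : Contour, (∀ a ∈ s, Γ.Encircles a) →
      Γ.oint (fun z => h z / rootProd s z) = L := by
  induction s using Multiset.induction with
  | empty =>
    intro h hh
    exact ⟨0, fun Γ _ => by simpa using oint_eq_zero_of_differentiable hh⟩
  | cons a s ih =>
    intro h hh
    obtain ⟨L, hL⟩ := ih _ (differentiable_dslope hh a)
    refine ⟨L + h a * if s = 0 then 1 else 0, fun Γ hΓ => ?_⟩
    have hs : ∀ b ∈ s, Γ.Encircles b := fun b hb => hΓ b (Multiset.mem_cons_of_mem hb)
    -- Subtracting `h a` cancels the factor `z - a`; the remaining pure pole part contributes only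
    -- when `a` is the sole root.
    have hpure : Γ.oint (fun z => (rootProd (a ::ₘ s) z)⁻¹) = if s = 0 then 1 else 0 := by
      split_ifs with h0
      · subst h0
        simpa only [rootProd_cons, rootProd_zero, mul_one] using (hΓ a (by simp)).2
      · have hpos := Multiset.card_pos.2 h0
        exact oint_inv_rootProd_eq_zero (s.card - 1) _ (by simp; omega) hΓ
    rw [← hL Γ hs, ← hpure, ← oint_const_mul, ← oint_add (continuousOn_div_rootProd hs
      (differentiable_dslope hh a).continuous.continuousOn)
      (continuousOn_const.fun_mul (continuousOn_inv_rootProd hΓ))]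
    refine oint_congr fun z hz => ?_
    have h1 := ne_of_mem_trace (hΓ a (by simp)).1 hz
    have h3 := rootProd_ne_zero hs hz
    have hd : h z = (z - a) * dslope h a z + h a := by
      rw [← smul_eq_mul, sub_smul_dslope]
      ring
    rw [rootProd_cons, hd]
    field_simp

/-- The Cauchy transform of `h / ∏ (z - a)`: up to the contribution of the pole at `η`, it is
given by an interpolation formula which does not depend on the contour. -/

lemma exists_oint_cauchy_div_rootProd_eq {h : ℂ → ℂ} (hh : Differentiable ℂ h)
    (s : Multiset ℂ) : ∃ r : ℂ → ℂ, Differentiable ℂ r ∧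
      ∀ Γ : Contour, (∀ a ∈ s, Γ.Encircles a) → ∀ η ∉ Γ.trace,
        rootProd s η * Γ.oint (fun z => h z / (η - z) / rootProd s z) =
          r η - Γ.oint (fun z => (z - η)⁻¹) * h η := by
  induction s using Multiset.induction with
  | empty =>
    refine ⟨fun _ => 0, differentiable_const _, fun Γ _ η hη => ?_⟩
    have hc : ContinuousOn (fun z => (z - η)⁻¹) Γ.trace :=
      (continuousOn_id.sub continuousOn_const).inv₀ fun z hz => ne_of_mem_trace hη hz
    have : Γ.oint (fun z => h z / (η - z) / rootProd 0 z) =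
        Γ.oint fun z => (-h η) * (z - η)⁻¹ - dslope h η z := by
      refine oint_congr fun z hz => ?_
      have h1 := ne_of_mem_trace hη hz
      have hd : h z = (z - η) * dslope h η z + h η := by
        rw [← smul_eq_mul, sub_smul_dslope]
        ring
      rw [rootProd_zero, hd, ← neg_sub z η]
      field_simp
      ring
    rw [this, oint_sub (continuousOn_const.fun_mul hc)
      (differentiable_dslope hh η).continuous.continuousOn, oint_const_mul,
      oint_eq_zero_of_differentiable (differentiable_dslope hh η), rootProd_zero]
    ring
  | cons a s ih =>
    obtain ⟨r, hr, hrΓ⟩ := ih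
    obtain ⟨L, hL⟩ := exists_oint_div_rootProd_eq (a ::ₘ s) h hh
    -- From `(η - a) / ((η - z) (z - a)) = 1 / (η - z) + 1 / (z - a)`: the first term gives the
    -- transform for `s`, the second an integral `L` free of `η`.
    refine ⟨fun η => r η + rootProd s η * L,
      hr.add ((differentiable_rootProd s).mul_const L), fun Γ hΓ η hη => ?_⟩
    have hs : ∀ b ∈ s, Γ.Encircles b := fun b hb => hΓ b (Multiset.mem_cons_of_mem hb)
    have hη' : ∀ z ∈ Γ.trace, η - z ≠ 0 := fun z hz => by
      rw [← neg_sub]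
      exact neg_ne_zero.2 (ne_of_mem_trace hη hz)
    have hc : ContinuousOn (fun z => h z / (η - z)) Γ.trace :=
      hh.continuous.continuousOn.div (continuousOn_const.sub continuousOn_id) hη'
    rw [← hL Γ hΓ, add_sub_right_comm, ← hrΓ Γ hs η hη, ← mul_add, ← oint_add
      (continuousOn_div_rootProd hs hc) (continuousOn_div_rootProd hΓ hh.continuous.continuousOn),
      ← oint_const_mul, ← oint_const_mul]
    refine oint_congr fun z hz => ?_
    have h1 := ne_of_mem_trace (hΓ a (by simp)).1 hz
    have h2 := hη' z hz
    have h3 := rootProd_ne_zero hs hz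
    simp only [rootProd_cons]
    field_simp
    ring

/-- The double contour integral of a kernel of Wishart type does not depend on the contours. -/

lemma exists_oint_oint_eq {A B : ℂ → ℂ} (hA : Differentiable ℂ A) (hB : Differentiable ℂ B)
    (s t : Multiset ℂ) : ∃ K : ℂ, ∀ Γ₁ Γ₂ : Contour, (∀ a ∈ s, Γ₁.Encircles a) →
      (∀ a ∈ t, Γ₂.Encircles a) → Disjoint Γ₁.trace Γ₂.trace →
      Γ₁.oint (fun η => Γ₂.oint fun z =>
        A η * B z / (η - z) * (rootProd s z / rootProd s η) *
          (rootProd t η / rootProd t z)) = K := by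
  obtain ⟨r, hr, hrΓ⟩ := exists_oint_cauchy_div_rootProd_eq
    (hB.mul (differentiable_rootProd s)) t
  obtain ⟨K, hK⟩ := exists_oint_div_rootProd_eq s _ (hA.mul hr)
  refine ⟨K, fun Γ₁ Γ₂ h₁ h₂ hd => ?_⟩
  -- The winding number of `Γ₂` about a point of `Γ₁`; disjointness makes it the same for every
  -- point of `Γ₁`.
  set w : ℂ := Γ₂.oint fun z => (z - Γ₁.base)⁻¹ with hw
  have hbase : Γ₁.base ∈ Γ₁.trace := ⟨0, Γ₁.path.source⟩
  have key : ∀ η ∈ Γ₁.trace, Γ₂.oint (fun z =>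
      A η * B z / (η - z) * (rootProd s z / rootProd s η) * (rootProd t η / rootProd t z)) =
      (A * r) η / rootProd s η - w * (A η * B η) := by
    intro η hη
    have hη₂ : η ∉ Γ₂.trace := Set.disjoint_left.1 hd hη
    have h0 := rootProd_ne_zero h₁ hη
    have h := hrΓ Γ₂ h₂ η hη₂
    rw [oint_inv_eq_of_disjoint hd hη hbase, ← hw, ← oint_const_mul] at h
    have : Γ₂.oint (fun z => A η * B z / (η - z) * (rootProd s z / rootProd s η) *
        (rootProd t η / rootProd t z)) = A η / rootProd s η *
          Γ₂.oint (fun z => rootProd t η * ((B * rootProd s) z / (η - z) / rootProd t z)) := by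
      rw [← oint_const_mul]
      refine oint_congr fun z _ => ?_
      simp only [Pi.mul_apply]
      ring
    rw [this, h]
    simp only [Pi.mul_apply]
    field_simp
  rw [oint_congr key, oint_sub (continuousOn_div_rootProd h₁ (hA.mul hr).continuous.continuousOn)
    (continuousOn_const.fun_mul (hA.fun_mul hB).continuous.continuousOn), oint_const_mul, hK Γ₁ h₁]
  -- In the term carrying `w` the factors `rootProd s η` have cancelled, so what is left is entire.
  have hAB : Γ₁.oint (fun η => A η * B η) = 0 := oint_eq_zero_of_differentiable (hA.mul hB)
  rw [hAB]
  ring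

/-! ### Limits under contour integrals. -/

lemma exists_norm_oint_le (Γ : Contour) : ∃ L : ℝ, ∀ (f : ℂ → ℂ) (C : ℝ),
    (∀ z ∈ Γ.trace, ‖f z‖ ≤ C) → ‖Γ.oint f‖ ≤ C * L := by
  refine ⟨‖(2 * (Real.pi : ℂ) * Complex.I)⁻¹‖ *
    ∫ t in (0 : ℝ)..1, ‖deriv Γ.path.extend t‖, fun f C hC => ?_⟩
  rw [oint_eq, norm_mul, mul_left_comm, ← intervalIntegral.integral_const_mul]
  refine mul_le_mul_of_nonneg_left ?_ (norm_nonneg _)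
  refine intervalIntegral.norm_integral_le_of_norm_le zero_le_one (Eventually.of_forall
    fun t _ => ?_) (Γ.intervalIntegrable_deriv.norm.const_mul C)
  rw [norm_mul]
  exact mul_le_mul_of_nonneg_right (hC _ (Γ.extend_mem_trace t)) (norm_nonneg _)

/-- Dominated convergence for a general filter: it serves both for `N → ∞` and for continuity in a
parameter. -/
lemma tendsto_oint {ι : Type*} {l : Filter ι} [l.IsCountablyGenerated] {F : ι → ℂ → ℂ}
    {f : ℂ → ℂ} (C : ℝ) (hF : ∀ᶠ i in l, ContinuousOn (F i) Γ.trace)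
    (hC : ∀ᶠ i in l, ∀ z ∈ Γ.trace, ‖F i z‖ ≤ C)
    (hlim : ∀ z ∈ Γ.trace, Tendsto (fun i => F i z) l (𝓝 (f z))) :
    Tendsto (fun i => Γ.oint (F i)) l (𝓝 (Γ.oint f)) := by
  simp only [oint_eq]
  refine Tendsto.const_mul _ ?_
  refine intervalIntegral.tendsto_integral_filter_of_dominated_convergence
    (fun t => C * ‖deriv Γ.path.extend t‖) ?_ ?_ (Γ.intervalIntegrable_deriv.norm.const_mul C) ?_
  · filter_upwards [hF] with i hi
    exact (intervalIntegrable_mul_deriv hi).def'.aestronglyMeasurable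
  · filter_upwards [hC] with i hi
    refine Eventually.of_forall fun t _ => ?_
    rw [norm_mul]
    exact mul_le_mul_of_nonneg_right (hi _ (Γ.extend_mem_trace t)) (norm_nonneg _)
  · exact Eventually.of_forall fun t _ => (hlim _ (Γ.extend_mem_trace t)).mul_const _

/-- Provides the continuity of the inner integral that the outer dominated convergence requires. -/
lemma continuousOn_oint {K : Set ℂ} (hK : IsCompact K) {f : ℂ × ℂ → ℂ}
    (hf : ContinuousOn f (K ×ˢ Γ.trace)) : ContinuousOn (fun v => Γ.oint fun u => f (v, u)) K := by
  obtain ⟨C, hC⟩ := (hK.prod Γ.isCompact_trace).exists_bound_of_continuousOn hf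
  intro v₀ hv₀
  refine tendsto_oint C ?_ ?_ fun u hu => ?_
  · filter_upwards [self_mem_nhdsWithin] with v hv
    exact hf.comp (by fun_prop) fun u hu => ⟨hv, hu⟩
  · filter_upwards [self_mem_nhdsWithin] with v hv u hu using hC _ ⟨hv, hu⟩
  · have : ContinuousOn (fun v => f (v, u)) K := hf.comp (by fun_prop) fun v hv => ⟨hv, hu⟩
    exact this v₀ hv₀

lemma tendsto_oint_oint {Γ₁ Γ₂ : Contour} {F : ℕ → ℂ × ℂ → ℂ} {f : ℂ × ℂ → ℂ} (C : ℝ)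
    (hF : ∀ᶠ N in atTop, ContinuousOn (F N) (Γ₁.trace ×ˢ Γ₂.trace))
    (hC : ∀ᶠ N in atTop, ∀ p ∈ Γ₁.trace ×ˢ Γ₂.trace, ‖F N p‖ ≤ C)
    (hlim : ∀ p ∈ Γ₁.trace ×ˢ Γ₂.trace, Tendsto (fun N => F N p) atTop (𝓝 (f p))) :
    Tendsto (fun N => Γ₁.oint fun v => Γ₂.oint fun u => F N (v, u)) atTop
      (𝓝 (Γ₁.oint fun v => Γ₂.oint fun u => f (v, u))) := by
  obtain ⟨L, hL⟩ := Γ₂.exists_norm_oint_le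
  refine tendsto_oint (C * L) ?_ ?_ fun v hv => ?_
  · filter_upwards [hF] with N hN using continuousOn_oint Γ₁.isCompact_trace hN
  · filter_upwards [hC] with N hN v hv using hL _ _ fun u hu => hN _ ⟨hv, hu⟩
  · refine tendsto_oint C ?_ ?_ fun u hu => hlim _ ⟨hv, hu⟩
    · filter_upwards [hF] with N hN
      exact hN.comp (by fun_prop) fun u hu => ⟨hv, hu⟩
    · filter_upwards [hC] with N hN u hu using hN _ ⟨hv, hu⟩

end Contour

/-! ### Uniform bounds and the exponential limit. -/

section Bounds

variable {X : Type*} {K : Set X}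

/-- The sequence of functions `F` is, from some index on, uniformly bounded on `K`. -/
def EventuallyBoundedOn (F : ℕ → X → ℂ) (K : Set X) : Prop :=
  ∃ C : ℝ, ∀ᶠ N in atTop, ∀ p ∈ K, ‖F N p‖ ≤ C

lemma EventuallyBoundedOn.mul {F G : ℕ → X → ℂ} (hF : EventuallyBoundedOn F K)
    (hG : EventuallyBoundedOn G K) : EventuallyBoundedOn (fun N p => F N p * G N p) K := by
  obtain ⟨C, hC⟩ := hF
  obtain ⟨D, hD⟩ := hG
  refine ⟨C * D, ?_⟩
  filter_upwards [hC, hD] with N h₁ h₂ p hp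
  rw [norm_mul]
  exact mul_le_mul (h₁ p hp) (h₂ p hp) (norm_nonneg _) ((norm_nonneg _).trans (h₁ p hp))

lemma EventuallyBoundedOn.prod {ι : Type*} {F : ι → ℕ → X → ℂ} (s : Finset ι)
    (hF : ∀ i ∈ s, EventuallyBoundedOn (F i) K) :
    EventuallyBoundedOn (fun N p => ∏ i ∈ s, F i N p) K := by
  classical
  induction s using Finset.induction with
  | empty => exact ⟨1, Eventually.of_forall fun N p _ => by simp⟩
  | insert i s hi ih =>
    simp only [Finset.prod_insert hi]
    exact (hF i (by simp)).mul (ih fun j hj => hF j (Finset.mem_insert_of_mem hj))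

lemma eventuallyBoundedOn_const [TopologicalSpace X] (hK : IsCompact K) {f : X → ℂ}
    (hf : ContinuousOn f K) : EventuallyBoundedOn (fun _ => f) K := by
  obtain ⟨C, hC⟩ := hK.exists_bound_of_continuousOn hf
  exact ⟨C, Eventually.of_forall fun _ => hC⟩

/-- A tube argument: if `C` bounds `g (a₀, ·)` on the compact set, then `C + 1` still bounds `g (b,
·)` there for all `b` near `a₀`. -/
lemma eventuallyBoundedOn_of_continuousAt [TopologicalSpace X] (hK : IsCompact K)
    {g : ℂ × X → ℂ} {a : ℕ → ℂ} {a₀ : ℂ} (ha : Tendsto a atTop (𝓝 a₀))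
    (hg : ∀ p ∈ K, ContinuousAt g (a₀, p)) : EventuallyBoundedOn (fun N p => g (a N, p)) K := by
  obtain ⟨C, hC⟩ := hK.exists_bound_of_continuousOn (f := fun p => g (a₀, p)) fun p hp =>
    ((hg p hp).comp (by fun_prop : ContinuousAt (fun p => (a₀, p)) p)).continuousWithinAt
  refine ⟨C + 1, ha.eventually (hK.eventually_forall_of_forall_eventually
    (P := fun b p => ‖g (b, p)‖ ≤ C + 1) fun p hp => ?_)⟩
  have := (hg p hp).norm.eventually_lt (continuousAt_const (y := C + 1))
    ((hC p hp).trans_lt (lt_add_one C))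
  exact this.mono fun _ h => h.le

lemma norm_one_add_div_pow_le {t : ℂ} {R : ℝ} (ht : ‖t‖ ≤ R) {N k : ℕ} (hN : 0 < N)
    (hk : k ≤ N) : ‖(1 + t / N) ^ k‖ ≤ Real.exp R := by
  have hN' : (0 : ℝ) < N := by exact_mod_cast hN
  have hR : 0 ≤ R := (norm_nonneg t).trans ht
  have h1 : ‖1 + t / N‖ ≤ Real.exp (R / N) := by
    calc ‖1 + t / N‖ ≤ 1 + ‖t‖ / N := by
          refine (norm_add_le _ _).trans ?_
          simp
      _ ≤ R / N + 1 := by rw [add_comm]; gcongr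
      _ ≤ _ := Real.add_one_le_exp _
  rw [norm_pow]
  calc ‖1 + t / N‖ ^ k ≤ Real.exp (R / N) ^ k := by gcongr
    _ ≤ Real.exp (R / N) ^ N := pow_le_pow_right₀ (Real.one_le_exp (by positivity)) hk
    _ = Real.exp R := by
      rw [← Real.exp_nat_mul]
      congr 1
      field_simp

lemma norm_inv_one_add_div_pow_le {t : ℂ} {R : ℝ} (ht : ‖t‖ ≤ R) {N k : ℕ} (hN : 0 < N)
    (hRN : 2 * R ≤ N) (hk : k ≤ N) : ‖((1 + t / N) ^ k)⁻¹‖ ≤ Real.exp (2 * R) := by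
  have hN' : (0 : ℝ) < N := by exact_mod_cast hN
  have hR : 0 ≤ R := (norm_nonneg t).trans ht
  have hx : R / N ≤ 1 / 2 := by
    rw [div_le_div_iff₀ hN' two_pos]
    linarith
  have hx0 : 0 ≤ R / N := by positivity
  have h1 : ‖1 + t / N‖⁻¹ ≤ Real.exp (2 * R / N) := by
    have h2 : 1 - R / N ≤ ‖1 + t / N‖ := by
      have := norm_sub_norm_le (1 : ℂ) (-(t / N))
      rw [norm_neg, sub_neg_eq_add, norm_one, norm_div, Complex.norm_natCast] at this
      refine le_trans ?_ this
      gcongr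
    calc ‖1 + t / N‖⁻¹ ≤ (1 - R / N)⁻¹ := inv_anti₀ (by linarith) h2
      -- `(1 - x) (1 + 2 x) ≥ 1` for `0 ≤ x ≤ 1/2`, with `x = R / N`; hence the condition `2 * R ≤
      -- N`.
      _ ≤ 2 * R / N + 1 := by
        rw [inv_le_iff_one_le_mul₀ (by linarith), mul_div_assoc]
        nlinarith
      _ ≤ _ := Real.add_one_le_exp _
  rw [norm_inv, norm_pow, ← inv_pow]
  calc ‖1 + t / N‖⁻¹ ^ k ≤ Real.exp (2 * R / N) ^ k := by gcongr
    _ ≤ Real.exp (2 * R / N) ^ N := pow_le_pow_right₀ (Real.one_le_exp (by positivity)) hk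
    _ = Real.exp (2 * R) := by
      rw [← Real.exp_nat_mul]
      congr 1
      field_simp

lemma tendsto_one_add_div_pow_sub (t : ℂ) (n : ℕ) :
    Tendsto (fun N : ℕ => (1 + t / (N : ℂ)) ^ (N - n)) atTop (𝓝 (Complex.exp t)) := by
  -- Shifting by `n` removes the truncated subtraction; then only `N * (t / (N + n)) → t` is needed.
  rw [← tendsto_add_atTop_iff_nat n]
  simp only [Nat.add_sub_cancel]
  refine Complex.tendsto_one_add_pow_exp_of_tendsto ?_
  have h : Tendsto (fun N : ℕ => (N : ℂ) / ((N : ℂ) + n)) atTop (𝓝 1) :=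
    tendsto_natCast_div_add_atTop (n : ℂ)
  have := h.const_mul t
  rw [mul_one] at this
  refine this.congr fun N => ?_
  push_cast
  ring

end Bounds

/-! ### The Wishart kernel and its rescaled integrand. -/

/-- The kernel of the generalised Wishart ensemble does not depend on the admissible contours. -/

lemma WishartContours.wishartKernel_eq {N M : ℕ} {σ q : ℕ → ℝ} {γσ γq γσ' γq' : Contour}
    (h : WishartContours N M σ q γσ γq) (h' : WishartContours N M σ q γσ' γq') (x y : ℝ) :
    wishartKernel N M σ q γσ γq x y = wishartKernel N M σ q γσ' γq' x y := by
  set s : Multiset ℂ := (Finset.Icc 1 N).val.map fun l => -(σ l : ℂ) with hs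
  set t : Multiset ℂ := (Finset.Icc 1 M).val.map fun k => (q k : ℂ) with ht
  have hsP : ∀ z, rootProd s z = ∏ l ∈ Finset.Icc 1 N, (z + (σ l : ℂ)) := fun z => by
    simp [rootProd, hs]
  have htP : ∀ z, rootProd t z = ∏ k ∈ Finset.Icc 1 M, (z - (q k : ℂ)) := fun z => by
    simp [rootProd, ht]
  obtain ⟨K, hK⟩ := Contour.exists_oint_oint_eq (A := fun η => Complex.exp (x * η))
    (B := fun z => Complex.exp (-(y * z))) (by fun_prop) (by fun_prop) s t
  have key : ∀ γ₁ γ₂ : Contour, WishartContours N M σ q γ₁ γ₂ →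
      wishartKernel N M σ q γ₁ γ₂ x y = K := by
    intro γ₁ γ₂ hγ
    rw [← hK γ₁ γ₂ ?_ ?_ hγ.disjoint]
    · simp only [wishartKernel, Finset.prod_div_distrib, hsP, htP, sub_eq_add_neg _ (_ * _ : ℂ),
        Complex.exp_add]
    · intro a ha
      obtain ⟨l, hl, rfl⟩ := Multiset.mem_map.1 ha
      exact hγ.sigma l hl
    · intro a ha
      obtain ⟨k, hk, rfl⟩ := Multiset.mem_map.1 ha
      exact hγ.q k hk
  rw [key _ _ h, key _ _ h']

/-- The integrand of the Wishart kernel in variables `w = (v, u)` rescaled at the hard edge, with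
rescaled parameters `p` and `θ`. -/
def rescaledIntegrand (N M : ℕ) (p θ : ℕ → ℂ) (x y : ℝ) (w : ℂ × ℂ) : ℂ :=
  Complex.exp (-(x * w.1) + y * w.2) / (w.2 - w.1) *
    (∏ l ∈ Finset.Icc 1 N, (w.2 - p l) / (w.1 - p l)) *
    ∏ k ∈ Finset.Icc 1 M, (w.1 - θ k) / (w.2 - θ k)

/-- The integrand of the perturbed Bessel kernel. -/
def besselIntegrand (n m ν : ℕ) (p θ : ℕ → ℂ) (x y : ℝ) (w : ℂ × ℂ) : ℂ :=
  Complex.exp (-(x * w.1) + y * w.2) / (w.2 - w.1) * Complex.exp (-(1 / w.2) + 1 / w.1) *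
    (w.1 / w.2) ^ ((ν : ℤ) + (n : ℤ) - (m : ℤ)) *
    (∏ l ∈ Finset.Icc 1 n, (w.2 - p l) / (w.1 - p l)) *
    ∏ k ∈ Finset.Icc 1 m, (w.1 - θ k) / (w.2 - θ k)

lemma prod_Icc_split {n N : ℕ} (h : n ≤ N) (f : ℕ → ℂ) (c : ℂ)
    (hf : ∀ l ∈ Finset.Icc (n + 1) N, f l = c) :
    ∏ l ∈ Finset.Icc 1 N, f l = (∏ l ∈ Finset.Icc 1 n, f l) * c ^ (N - n) := by
  have hu : Finset.Icc 1 N = Finset.Icc 1 n ∪ Finset.Icc (n + 1) N := by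
    ext l
    simp only [Finset.mem_union, Finset.mem_Icc]
    omega
  have hd : Disjoint (Finset.Icc 1 n) (Finset.Icc (n + 1) N) := by
    refine Finset.disjoint_left.2 fun l h₁ h₂ => ?_
    simp only [Finset.mem_Icc] at h₁ h₂
    omega
  rw [hu, Finset.prod_union hd, Finset.prod_congr rfl hf, Finset.prod_const, Nat.card_Icc]
  congr 2
  omega

lemma rescaledIntegrand_eq {n m ν N : ℕ} (hn : n ≤ N) (hm : m ≤ N) {p θ : ℕ → ℂ}
    (hp : ∀ l ∈ Finset.Icc (n + 1) N, p l = 1 / (N : ℂ))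
    (hθ : ∀ k ∈ Finset.Icc (m + 1) (N + ν), θ k = 0) (x y : ℝ) {w : ℂ × ℂ}
    (hv : w.1 ≠ 0) (hu : w.2 ≠ 0) :
    rescaledIntegrand N (N + ν) p θ x y w =
      Complex.exp (-(x * w.1) + y * w.2) / (w.2 - w.1) *
        ((1 + -(1 / w.2) / N) ^ (N - n) * ((1 + -(1 / w.1) / N) ^ (N - n))⁻¹) *
        (w.1 / w.2) ^ ((ν : ℤ) + (n : ℤ) - (m : ℤ)) *
        (∏ l ∈ Finset.Icc 1 n, (w.2 - p l) / (w.1 - p l)) *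
        ∏ k ∈ Finset.Icc 1 m, (w.1 - θ k) / (w.2 - θ k) := by
  obtain ⟨v, u⟩ := w
  simp only at hv hu ⊢
  have hfac : ∀ z : ℂ, z ≠ 0 → z - 1 / (N : ℂ) = z * (1 + -(1 / z) / N) := fun z hz => by
    rw [mul_add, mul_one, ← mul_div_assoc, mul_neg, mul_one_div_cancel hz]
    ring
  -- Net exponent `(N + ν - m) - (N - n) = ν + n - m`, possibly negative.
  have hzpow : (u / v) ^ (N - n) * (v / u) ^ (N + ν - m) =
      (v / u) ^ ((ν : ℤ) + (n : ℤ) - (m : ℤ)) := by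
    have hvu : v / u ≠ 0 := div_ne_zero hv hu
    rw [← inv_div v u, inv_pow, ← zpow_natCast, ← zpow_natCast, ← zpow_neg, ← zpow_add₀ hvu]
    congr 1
    push_cast [Nat.cast_sub hn, Nat.cast_sub (hm.trans (Nat.le_add_right N ν))]
    ring
  rw [rescaledIntegrand,
    prod_Icc_split hn _ ((u - 1 / (N : ℂ)) / (v - 1 / (N : ℂ))) fun l hl => by rw [hp l hl],
    prod_Icc_split (hm.trans (Nat.le_add_right N ν)) _ (v / u) fun k hk => by
      rw [hθ k hk, sub_zero, sub_zero],
    hfac u hu, hfac v hv, mul_div_mul_comm, mul_pow, ← hzpow, div_pow (1 + -(1 / u) / (N : ℂ))]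
  ring

/-! ### Convergence and domination of the rescaled integrand. -/

section Limit

variable {n m ν : ℕ} {p θ : ℕ → ℕ → ℂ} {πh θh : ℕ → ℂ} {K₁ K₂ : Set ℂ}

/-- Points off the poles of the integrand of the perturbed Bessel kernel. -/
structure BesselRegular (n m : ℕ) (πh θh : ℕ → ℂ) (K₁ K₂ : Set ℂ) : Prop where
  zero_left : (0 : ℂ) ∉ K₁
  zero_right : (0 : ℂ) ∉ K₂
  pi : ∀ l ∈ Finset.Icc 1 n, πh l ∉ K₁
  theta : ∀ k ∈ Finset.Icc 1 m, θh k ∉ K₂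
  disjoint : Disjoint K₁ K₂

lemma continuousOn_rescaledIntegrand {N M : ℕ} {p θ : ℕ → ℂ} (x y : ℝ)
    (hp : ∀ l ∈ Finset.Icc 1 N, p l ∉ K₁) (hθ : ∀ k ∈ Finset.Icc 1 M, θ k ∉ K₂)
    (hd : Disjoint K₁ K₂) : ContinuousOn (rescaledIntegrand N M p θ x y) (K₁ ×ˢ K₂) := by
  unfold rescaledIntegrand
  refine ((ContinuousOn.div (by fun_prop) (by fun_prop) ?_).mul
    (continuousOn_finsetProd _ fun l hl => ContinuousOn.div (by fun_prop) (by fun_prop) ?_)).mul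
    (continuousOn_finsetProd _ fun k hk => ContinuousOn.div (by fun_prop) (by fun_prop) ?_)
  · rintro ⟨v, u⟩ ⟨hv, hu⟩
    exact sub_ne_zero.2 fun h : u = v => Set.disjoint_left.1 hd hv (h ▸ hu)
  · rintro ⟨v, u⟩ ⟨hv, hu⟩
    exact sub_ne_zero.2 fun h : v = p l => hp l hl (h ▸ hv)
  · rintro ⟨v, u⟩ ⟨hv, hu⟩
    exact sub_ne_zero.2 fun h : u = θ k => hθ k hk (h ▸ hu)

lemma eventually_rescaledIntegrand_eq
    (hp : ∀ N, ∀ l ∈ Finset.Icc (n + 1) N, p N l = 1 / (N : ℂ))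
    (hθ : ∀ N, ∀ k ∈ Finset.Icc (m + 1) (N + ν), θ N k = 0) (x y : ℝ)
    (hK : BesselRegular n m πh θh K₁ K₂) :
    ∀ᶠ N : ℕ in atTop, ∀ w ∈ K₁ ×ˢ K₂, rescaledIntegrand N (N + ν) (p N) (θ N) x y w =
      Complex.exp (-(x * w.1) + y * w.2) / (w.2 - w.1) *
        ((1 + -(1 / w.2) / N) ^ (N - n) * ((1 + -(1 / w.1) / N) ^ (N - n))⁻¹) *
        (w.1 / w.2) ^ ((ν : ℤ) + (n : ℤ) - (m : ℤ)) *
        (∏ l ∈ Finset.Icc 1 n, (w.2 - p N l) / (w.1 - p N l)) *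
        ∏ k ∈ Finset.Icc 1 m, (w.1 - θ N k) / (w.2 - θ N k) := by
  filter_upwards [eventually_ge_atTop n, eventually_ge_atTop m] with N hn hm
  rintro ⟨v, u⟩ ⟨hv, hu⟩
  exact rescaledIntegrand_eq hn hm (hp N) (hθ N) x y (fun h : v = 0 => hK.zero_left (h ▸ hv))
    (fun h : u = 0 => hK.zero_right (h ▸ hu))

lemma tendsto_rescaledIntegrand
    (hp : ∀ N, ∀ l ∈ Finset.Icc (n + 1) N, p N l = 1 / (N : ℂ))
    (hθ : ∀ N, ∀ k ∈ Finset.Icc (m + 1) (N + ν), θ N k = 0)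
    (hπ : ∀ l ∈ Finset.Icc 1 n, Tendsto (fun N => p N l) atTop (𝓝 (πh l)))
    (hθh : ∀ k ∈ Finset.Icc 1 m, Tendsto (fun N => θ N k) atTop (𝓝 (θh k))) (x y : ℝ)
    (hK : BesselRegular n m πh θh K₁ K₂) {w : ℂ × ℂ} (hw : w ∈ K₁ ×ˢ K₂) :
    Tendsto (fun N => rescaledIntegrand N (N + ν) (p N) (θ N) x y w) atTop
      (𝓝 (besselIntegrand n m ν πh θh x y w)) := by
  refine Tendsto.congr' ((eventually_rescaledIntegrand_eq hp hθ x y hK).mono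
    fun N hN => (hN w hw).symm) ?_
  obtain ⟨v, u⟩ := w
  obtain ⟨hv, hu⟩ := hw
  -- `exp (1/v)` is written as the inverse of `exp (-1/v)`, the form in which it arises from the
  -- denominators.
  rw [besselIntegrand, Complex.exp_add (-(1 / _)), ← neg_neg (1 / v), Complex.exp_neg (-(1 / v)),
    neg_neg]
  refine ((((((tendsto_one_add_div_pow_sub _ n).mul
    ((tendsto_one_add_div_pow_sub _ n).inv₀ (Complex.exp_ne_zero _))).const_mul _).mul_const
      _).mul (tendsto_finsetProd _ fun l hl => ?_)).mul (tendsto_finsetProd _ fun k hk => ?_))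
  · exact (tendsto_const_nhds.sub (hπ l hl)).div (tendsto_const_nhds.sub (hπ l hl))
      (sub_ne_zero.2 fun h : v = πh l => hK.pi l hl (h ▸ hv))
  · exact (tendsto_const_nhds.sub (hθh k hk)).div (tendsto_const_nhds.sub (hθh k hk))
      (sub_ne_zero.2 fun h : u = θh k => hK.theta k hk (h ▸ hu))

lemma eventuallyBoundedOn_rescaledIntegrand (h₁ : IsCompact K₁) (h₂ : IsCompact K₂)
    (hp : ∀ N, ∀ l ∈ Finset.Icc (n + 1) N, p N l = 1 / (N : ℂ))
    (hθ : ∀ N, ∀ k ∈ Finset.Icc (m + 1) (N + ν), θ N k = 0)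
    (hπ : ∀ l ∈ Finset.Icc 1 n, Tendsto (fun N => p N l) atTop (𝓝 (πh l)))
    (hθh : ∀ k ∈ Finset.Icc 1 m, Tendsto (fun N => θ N k) atTop (𝓝 (θh k))) (x y : ℝ)
    (hK : BesselRegular n m πh θh K₁ K₂) :
    EventuallyBoundedOn (fun N => rescaledIntegrand N (N + ν) (p N) (θ N) x y) (K₁ ×ˢ K₂) := by
  have hK₁₂ := h₁.prod h₂
  have hv0 : ∀ w ∈ K₁ ×ˢ K₂, w.1 ≠ 0 := fun w hw h => hK.zero_left (h ▸ hw.1)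
  have hu0 : ∀ w ∈ K₁ ×ˢ K₂, w.2 ≠ 0 := fun w hw h => hK.zero_right (h ▸ hw.2)
  have huv : ∀ w ∈ K₁ ×ˢ K₂, w.2 - w.1 ≠ 0 := fun w hw =>
    sub_ne_zero.2 fun h => Set.disjoint_left.1 hK.disjoint hw.1 (h ▸ hw.2)
  have hexp : EventuallyBoundedOn (fun (N : ℕ) (w : ℂ × ℂ) =>
      (1 + -(1 / w.2) / (N : ℂ)) ^ (N - n) * ((1 + -(1 / w.1) / (N : ℂ)) ^ (N - n))⁻¹)
      (K₁ ×ˢ K₂) := by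
    obtain ⟨R₁, hR₁⟩ := hK₁₂.exists_bound_of_continuousOn (f := fun w => -(1 / w.1))
      (ContinuousOn.neg (ContinuousOn.div (by fun_prop) (by fun_prop) hv0))
    obtain ⟨R₂, hR₂⟩ := hK₁₂.exists_bound_of_continuousOn (f := fun w => -(1 / w.2))
      (ContinuousOn.neg (ContinuousOn.div (by fun_prop) (by fun_prop) hu0))
    refine EventuallyBoundedOn.mul ⟨Real.exp R₂, ?_⟩ ⟨Real.exp (2 * R₁), ?_⟩
    · filter_upwards [eventually_gt_atTop 0] with N hN w hw
      exact norm_one_add_div_pow_le (hR₂ w hw) hN (Nat.sub_le _ _)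
    · filter_upwards [eventually_gt_atTop 0,
        tendsto_natCast_atTop_atTop.eventually (eventually_ge_atTop (2 * R₁))] with N hN hRN w hw
      exact norm_inv_one_add_div_pow_le (hR₁ w hw) hN hRN (Nat.sub_le _ _)
  have hconst : EventuallyBoundedOn (fun (_ : ℕ) (w : ℂ × ℂ) =>
      Complex.exp (-(x * w.1) + y * w.2) / (w.2 - w.1)) (K₁ ×ˢ K₂) :=
    eventuallyBoundedOn_const hK₁₂ (ContinuousOn.div (by fun_prop) (by fun_prop) huv)
  have hpow : EventuallyBoundedOn (fun (_ : ℕ) (w : ℂ × ℂ) =>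
      (w.1 / w.2) ^ ((ν : ℤ) + (n : ℤ) - (m : ℤ))) (K₁ ×ˢ K₂) :=
    eventuallyBoundedOn_const hK₁₂ ((ContinuousOn.div (by fun_prop) (by fun_prop) hu0).zpow₀ _
      fun w hw => Or.inl (div_ne_zero (hv0 w hw) (hu0 w hw)))
  have hprod₁ : EventuallyBoundedOn (fun (N : ℕ) (w : ℂ × ℂ) =>
      ∏ l ∈ Finset.Icc 1 n, (w.2 - p N l) / (w.1 - p N l)) (K₁ ×ˢ K₂) :=
    EventuallyBoundedOn.prod _ fun l hl => eventuallyBoundedOn_of_continuousAt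
      (g := fun a => (a.2.2 - a.1) / (a.2.1 - a.1)) hK₁₂ (hπ l hl) fun w hw =>
        ContinuousAt.div (by fun_prop) (by fun_prop)
          (sub_ne_zero.2 fun h : w.1 = πh l => hK.pi l hl (h ▸ hw.1))
  have hprod₂ : EventuallyBoundedOn (fun (N : ℕ) (w : ℂ × ℂ) =>
      ∏ k ∈ Finset.Icc 1 m, (w.1 - θ N k) / (w.2 - θ N k)) (K₁ ×ˢ K₂) :=
    EventuallyBoundedOn.prod _ fun k hk => eventuallyBoundedOn_of_continuousAt
      (g := fun a => (a.2.1 - a.1) / (a.2.2 - a.1)) hK₁₂ (hθh k hk) fun w hw =>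
        ContinuousAt.div (by fun_prop) (by fun_prop)
          (sub_ne_zero.2 fun h : w.2 = θh k => hK.theta k hk (h ▸ hw.2))
  obtain ⟨C, hC⟩ := (((hconst.mul hexp).mul hpow).mul hprod₁).mul hprod₂
  refine ⟨C, ?_⟩
  filter_upwards [hC, eventually_rescaledIntegrand_eq hp hθ x y hK] with N hN hN' w hw
  rw [hN' w hw]
  exact hN w hw

end Limit

/-! ### Change of variables and conclusion. -/

/-- The Wishart kernel along affine images of contours, in rescaled variables. -/

lemma wishartKernel_affine (N M : ℕ) (σ q : ℕ → ℝ) (Γ₁ Γ₂ : Contour) {s : ℝ} (hs : s ≠ 0)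
    (b x y : ℝ) (p θ : ℕ → ℂ) (hp : ∀ l ∈ Finset.Icc 1 N, (b + σ l : ℂ) = s * p l)
    (hθ : ∀ k ∈ Finset.Icc 1 M, (b - q k : ℂ) = s * θ k) :
    ((1 / s : ℝ) : ℂ) * wishartKernel N M σ q (Γ₁.affine (-s) b) (Γ₂.affine (-s) b)
        (x / s) (y / s) * ((Real.exp (-(b / s) * (x - y)) : ℝ) : ℂ) =
      Γ₁.oint fun v => Γ₂.oint fun u => rescaledIntegrand N M p θ x y (v, u) := by
  have hs' : (s : ℂ) ≠ 0 := by exact_mod_cast hs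
  rw [wishartKernel, Contour.affine_oint, mul_comm, ← mul_assoc, ← mul_assoc,
    ← Contour.oint_const_mul]
  refine Contour.oint_congr fun v _ => ?_
  rw [Contour.affine_oint, ← mul_assoc, ← Contour.oint_const_mul]
  refine Contour.oint_congr fun u _ => ?_
  have h₁ : ∀ l ∈ Finset.Icc 1 N, (-(s : ℂ) * u + b + σ l) / (-(s : ℂ) * v + b + σ l) =
      (u - p l) / (v - p l) := fun l hl => by
    rw [add_assoc, add_assoc, hp l hl, show -(s : ℂ) * u + s * p l = -s * (u - p l) by ring,
      show -(s : ℂ) * v + s * p l = -s * (v - p l) by ring,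
      mul_div_mul_left _ _ (neg_ne_zero.2 hs')]
  have h₂ : ∀ k ∈ Finset.Icc 1 M, (-(s : ℂ) * v + b - q k) / (-(s : ℂ) * u + b - q k) =
      (v - θ k) / (u - θ k) := fun k hk => by
    rw [add_sub_assoc, add_sub_assoc, hθ k hk,
      show -(s : ℂ) * u + s * θ k = -s * (u - θ k) by ring,
      show -(s : ℂ) * v + s * θ k = -s * (v - θ k) by ring,
      mul_div_mul_left _ _ (neg_ne_zero.2 hs')]
  -- The two Jacobians give `(-s) ^ 2`; one `s` cancels here against `η - ζ`, the other against the
  -- prefactor `1 / s`.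
  have h₃ : -(s : ℂ) * v + b - (-s * u + b) = s * (u - v) := by ring
  have h₄ : Complex.exp (-(x * v) + y * u) = Complex.exp (-(b / s) * (x - y)) *
      Complex.exp (x / s * (-(s : ℂ) * v + b) - y / s * (-s * u + b)) := by
    rw [← Complex.exp_add]
    congr 1
    field_simp
    ring
  rw [rescaledIntegrand, Finset.prod_congr rfl h₁, Finset.prod_congr rfl h₂, h₃]
  push_cast
  rw [h₄, div_eq_mul_inv _ ((s : ℂ) * _), mul_inv]
  field_simp

lemma BesselContours.besselRegular {n m : ℕ} {πh θh : ℕ → ℝ} {Γout Γin : Contour}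
    (h : BesselContours n m πh θh Γout Γin) :
    BesselRegular n m (fun l => (πh l : ℂ)) (fun k => (θh k : ℂ)) Γout.trace Γin.trace where
  zero_left := (h.nested 0 (Or.inr h.zero)).1
  zero_right := h.zero.1
  pi l hl := (h.pi l hl).1
  theta k hk := (h.theta k hk).1
  disjoint := Set.disjoint_right.2 fun z hz => (h.nested z (Or.inl hz)).1

lemma Contour.disjoint_affine {Γ₁ Γ₂ : Contour} (h : Disjoint Γ₁.trace Γ₂.trace) {c : ℂ}
    (hc : c ≠ 0) (b : ℂ) : Disjoint (Γ₁.affine c b).trace (Γ₂.affine c b).trace := by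
  rw [affine_trace, affine_trace]
  exact Set.disjoint_image_of_injective
    ((add_left_injective b).comp (mul_right_injective₀ hc)) h

end HardEdge

end

theorem theorem7
    -- `ν = M - N` and the numbers `n`, `m` of perturbed eigenvalues are fixed
    (ν n m : ℕ)
    -- degenerate eigenvalues `σ₀`, `q₀` of `Σ`, `Q` (constants are a special case)
    (σ₀ q₀ : ℕ → ℝ)
    -- eigenvalues `σ N 1, …, σ N N` of `Σ` and `q N 1, …, q N (N + ν)` of `Q` at matrix size `N`
    (σ q : ℕ → ℕ → ℝ)
    (hσq₀ : ∀ N, 0 < q₀ N + σ₀ N)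
    (hσq : ∀ N, ∀ i ∈ Finset.Icc 1 N, ∀ j ∈ Finset.Icc 1 (N + ν), 0 < q N j + σ N i)
    -- finite rank perturbations
    (hσ : ∀ N, ∀ l ∈ Finset.Icc (n + 1) N, σ N l = σ₀ N)
    (hq : ∀ N, ∀ k ∈ Finset.Icc (m + 1) (N + ν), q N k = q₀ N)
    -- rescaled parameters
    (πh θh : ℕ → ℝ)
    (hπ : ∀ l ∈ Finset.Icc 1 n,
      Tendsto (fun N : ℕ => (q₀ N + σ N l) / (q₀ N + σ₀ N) / (N : ℝ)) atTop (𝓝 (πh l)))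
    (hθ : ∀ k ∈ Finset.Icc 1 m,
      Tendsto (fun N : ℕ => (q₀ N - q N k) / (q₀ N + σ₀ N) / (N : ℝ)) atTop (𝓝 (θh k)))
    -- arbitrary admissible contours of the finite-size kernels and of the limiting kernel
    (γσ γq : ℕ → Contour)
    (hγ : ∀ N, WishartContours N (N + ν) (σ N) (q N) (γσ N) (γq N))
    (Γout Γin : Contour) (hΓ : BesselContours n m πh θh Γout Γin)
    (x y : ℝ) :
    Tendsto
      (fun N : ℕ =>
        ((1 / ((q₀ N + σ₀ N) * N) : ℝ) : ℂ) *
          wishartKernel N (N + ν) (σ N) (q N) (γσ N) (γq N)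
            (x / ((q₀ N + σ₀ N) * N)) (y / ((q₀ N + σ₀ N) * N)) *
          ((Real.exp (-(q₀ N / ((q₀ N + σ₀ N) * N)) * (x - y)) : ℝ) : ℂ))
      atTop (𝓝 (perturbedBesselKernel n m ν πh θh Γout Γin x y)) := by
  have hs : ∀ N, q₀ N + σ₀ N ≠ 0 := fun N => (hσq₀ N).ne'
  have hK := hΓ.besselRegular
  set p : ℕ → ℕ → ℂ := fun N l => (((q₀ N + σ N l) / (q₀ N + σ₀ N) / (N : ℝ) : ℝ) : ℂ) with hp
  set θ : ℕ → ℕ → ℂ := fun N k => (((q₀ N - q N k) / (q₀ N + σ₀ N) / (N : ℝ) : ℝ) : ℂ) with hθ'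
  have hpn : ∀ N, ∀ l ∈ Finset.Icc (n + 1) N, p N l = 1 / (N : ℂ) := fun N l hl => by
    simp only [hp, hσ N l hl, div_self (hs N)]
    push_cast
    rfl
  have hθm : ∀ N, ∀ k ∈ Finset.Icc (m + 1) (N + ν), θ N k = 0 := fun N k hk => by
    simp [hθ', hq N k hk]
  have hplim : ∀ l ∈ Finset.Icc 1 n, Tendsto (fun N => p N l) atTop (𝓝 (πh l : ℂ)) :=
    fun l hl => (Complex.continuous_ofReal.tendsto _).comp (hπ l hl)
  have hθlim : ∀ k ∈ Finset.Icc 1 m, Tendsto (fun N => θ N k) atTop (𝓝 (θh k : ℂ)) :=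
    fun k hk => (Complex.continuous_ofReal.tendsto _).comp (hθ k hk)
  -- The perturbed points converge to points encircled by `Γout`; the others equal `1 / N`, which
  -- tends to the origin, encircled by `Γout` because `Γin` encircles it.
  have hpenc : ∀ᶠ N in atTop, ∀ l ∈ Finset.Icc 1 N, Γout.Encircles (p N l) := by
    have h₁ : ∀ᶠ N : ℕ in atTop, Γout.Encircles (1 / (N : ℂ)) :=
      tendsto_one_div_atTop_nhds_zero_nat.eventually (hΓ.nested 0 (Or.inr hΓ.zero)).eventually
    have h₂ : ∀ᶠ N in atTop, ∀ l ∈ Finset.Icc 1 n, Γout.Encircles (p N l) :=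
      (Finset.eventually_all _).2 fun l hl => (hplim l hl).eventually (hΓ.pi l hl).eventually
    filter_upwards [h₁, h₂] with N h₁ h₂ l hl
    rw [Finset.mem_Icc] at hl
    by_cases hln : l ≤ n
    · exact h₂ l (Finset.mem_Icc.2 ⟨hl.1, hln⟩)
    · rw [hpn N l (Finset.mem_Icc.2 ⟨by omega, hl.2⟩)]
      exact h₁
  have hθenc : ∀ᶠ N in atTop, ∀ k ∈ Finset.Icc 1 (N + ν), Γin.Encircles (θ N k) := by
    have h₂ : ∀ᶠ N in atTop, ∀ k ∈ Finset.Icc 1 m, Γin.Encircles (θ N k) :=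
      (Finset.eventually_all _).2 fun k hk => (hθlim k hk).eventually (hΓ.theta k hk).eventually
    filter_upwards [h₂] with N h₂ k hk
    rw [Finset.mem_Icc] at hk
    by_cases hkm : k ≤ m
    · exact h₂ k (Finset.mem_Icc.2 ⟨hk.1, hkm⟩)
    · rw [hθm N k (Finset.mem_Icc.2 ⟨by omega, hk.2⟩)]
      exact hΓ.zero
  obtain ⟨C, hC⟩ := eventuallyBoundedOn_rescaledIntegrand Γout.isCompact_trace
    Γin.isCompact_trace hpn hθm hplim hθlim x y hK
  have hker : perturbedBesselKernel n m ν πh θh Γout Γin x y = Γout.oint fun v => Γin.oint fun u =>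
      besselIntegrand n m ν (fun l => (πh l : ℂ)) (fun k => (θh k : ℂ)) x y (v, u) := rfl
  rw [hker]
  refine Tendsto.congr' ?_ (Contour.tendsto_oint_oint C ?_ hC fun w hw =>
    tendsto_rescaledIntegrand hpn hθm hplim hθlim x y hK hw)
  -- At `N = 0` the scale `s` vanishes and the affine map degenerates.
  · filter_upwards [hpenc, hθenc, eventually_gt_atTop 0] with N hpN hθN hN
    have hN' : (N : ℝ) ≠ 0 := by exact_mod_cast hN.ne'
    set s : ℝ := (q₀ N + σ₀ N) * N with hsdef
    have hs0 : s ≠ 0 := mul_ne_zero (hs N) hN'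
    have hc : -(s : ℂ) ≠ 0 := neg_ne_zero.2 (by exact_mod_cast hs0)
    have hps : ∀ l, (q₀ N + σ N l : ℂ) = s * p N l := fun l => by
      have : q₀ N + σ N l = s * ((q₀ N + σ N l) / (q₀ N + σ₀ N) / (N : ℝ)) := by
        rw [hsdef]
        field_simp [hs N]
      simp only [hp]
      rw [← Complex.ofReal_add, ← Complex.ofReal_mul, ← this]
    have hθs : ∀ k, (q₀ N - q N k : ℂ) = s * θ N k := fun k => by
      have : q₀ N - q N k = s * ((q₀ N - q N k) / (q₀ N + σ₀ N) / (N : ℝ)) := by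
        rw [hsdef]
        field_simp [hs N]
      simp only [hθ']
      rw [← Complex.ofReal_sub, ← Complex.ofReal_mul, ← this]
    -- The map `z ↦ -s z + q₀` sends `p N l` to `-σ N l` and `θ N k` to `q N k`.
    have hW : WishartContours N (N + ν) (σ N) (q N) (Γout.affine (-s) (q₀ N))
        (Γin.affine (-s) (q₀ N)) := by
      refine ⟨fun l hl => ?_, fun k hk => ?_, Contour.disjoint_affine hK.disjoint hc _⟩
      · have := (hpN l hl).affine hc (q₀ N : ℂ)
        rwa [neg_mul, ← hps, neg_add_rev, neg_add_cancel_right] at this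
      · have := (hθN k hk).affine hc (q₀ N : ℂ)
        rwa [neg_mul, ← hθs, neg_sub, sub_add_cancel] at this
    rw [(hγ N).wishartKernel_eq hW, wishartKernel_affine N (N + ν) (σ N) (q N) Γout Γin hs0
      (q₀ N) x y (p N) (θ N) (fun l _ => hps l) fun k _ => hθs k]
  · filter_upwards [hpenc, hθenc] with N hpN hθN
    exact continuousOn_rescaledIntegrand x y (fun l hl => (hpN l hl).1)
      (fun k hk => (hθN k hk).1) hK.disjoint
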